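/- Let $n\ge 1$ and let $(d)=(d_1,\dots,d_n)$ be positive integers with maximum $D=\max_i d_i$. Let $\mathcal H_{(d)}$ be the space of systems $f=(f_1,\dots,f_n)$ of homogeneous polynomials $f_i\in\mathbb C[X_0,\dots,X_n]$ of degree $d_i$, with the unitarily invariant (Bombieri–Weyl) Hermitian structure: if $f_i=\sum_{|\alpha|=d_i} a_{i,\alpha}X^\alpha$ and $g_i=\sum_{|\alpha|=d_i} b_{i,\alpha}X^\alpha$, then $\langle f,g\rangle=\sum_{i}\sum_{|\alpha|=d_i}\binom{d_i}{\alpha}^{-1}a_{i,\alpha}\overline{b_{i,\alpha}}$ with $\binom{d_i}{\alpha}=\frac{d_i!}{\alpha_0!\cdots\alpha_n!}$. Let $\mathbb C^{n+1}$ carry its standard Hermitian structure. On $\mathbb P(\mathcal H_{(d)})$ and on $\mathbb P(\mathbb C^{n+1})$ let $d$ be the Riemannian distance given by the angle, $d(u,v)=\arccos\frac{|\langle u,v\rangle|}{\|u\|\,\|v\|}\in[0,\pi/2]$. For $f\in\mathbb P(\mathcal H_{(d)})$ and $\zeta\in\mathbb P(\mathbb C^{n+1})$ let $$\mu_{norm}(f,\zeta)=\|f\|\,\bigl\|\bigl(Df(\zeta)|_{N_\zeta}\bigr)^{-1}\Delta\bigl(d_i^{1/2}\|\zeta\|^{d_i-1}\bigr)\bigr\|\in(0,\infty],$$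 where $N_\zeta$ is the Hermitian complement of $\zeta$, $\Delta(a_i)$ is the $n\times n$ diagonal matrix with diagonal entries $a_i$, the second norm is the operator norm, and $\mu_{norm}(f,\zeta)=\infty$ if $Df(\zeta)|_{N_\zeta}$ is not invertible (this does not depend on the chosen representatives of $f$ and $\zeta$). Theorem. For every $\epsilon>0$ there is a constant $C>0$, depending only on $\epsilon$ (not on $n$ or $(d)$), such that for all $n$ and $(d)$ as above, all $f,g\in\mathbb P(\mathcal H_{(d)})$ and all $\zeta,\eta\in\mathbb P(\mathbb C^{n+1})$: if $$d(f,g)<\frac{C}{D^{1/2}\mu_{norm}(f,\zeta)}\quad\text{and}\quad d(\zeta,\eta)<\frac{C}{D^{3/2}\mu_{norm}(f,\zeta)}$$ (where $C/\infty=0$), then $$\frac1{1+\epsilon}\,\mu_{norm}(g,\eta)\le\mu_{norm}(f,\zeta)\le(1+\epsilon)\,\mu_{norm}(g,\eta).$$ -/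

import Mathlib

open scoped ENNReal LinearAlgebra.Projectivization ComplexConjugate

noncomputable section

namespace Bezout

/-! ### Homogeneous polynomials with the Bombieri-Weyl Hermitian structure -/

/-- The space of homogeneous polynomials of degree `l` in `X₀, …, Xₙ` with complex coefficients. -/
def HomogPoly (n l : ℕ) : Type :=
  ↥(MvPolynomial.homogeneousSubmodule (Fin (n + 1)) ℂ l)

namespace HomogPoly

variable {n l : ℕ}

instance : AddCommGroup (HomogPoly n l) :=
  inferInstanceAs (AddCommGroup ↥(MvPolynomial.homogeneousSubmodule (Fin (n + 1)) ℂ l))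

instance : Module ℂ (HomogPoly n l) :=
  inferInstanceAs (Module ℂ ↥(MvPolynomial.homogeneousSubmodule (Fin (n + 1)) ℂ l))

/-- The underlying polynomial. -/
def toPoly (p : HomogPoly n l) : MvPolynomial (Fin (n + 1)) ℂ := p.1

theorem toPoly_add (p q : HomogPoly n l) : (p + q).toPoly = p.toPoly + q.toPoly := rfl

theorem toPoly_smul (c : ℂ) (p : HomogPoly n l) : (c • p).toPoly = c • p.toPoly := rfl

theorem isHomogeneous (p : HomogPoly n l) : p.toPoly.IsHomogeneous l :=
  (MvPolynomial.mem_homogeneousSubmodule l p.1).1 p.2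

/-- The Bombieri-Weyl (Kostlan) Hermitian product: if `p = ∑ p_α X^α` and `q = ∑ q_α X^α`
(sums over the multi-indices with `|α| = l`), it is
`∑ conj p_α * q_α / (l! / (α₀! ⋯ αₙ!))`. -/
def weylInner (p q : HomogPoly n l) : ℂ :=
  ∑ α ∈ Finset.finsuppAntidiag (Finset.univ : Finset (Fin (n + 1))) l,
    conj (p.toPoly.coeff α) * q.toPoly.coeff α /
      (Nat.multinomial (Finset.univ : Finset (Fin (n + 1))) α : ℂ)

theorem weylInner_self (p : HomogPoly n l) :
    weylInner p p = ((∑ α ∈ Finset.finsuppAntidiag (Finset.univ : Finset (Fin (n + 1))) l,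
      ‖p.toPoly.coeff α‖ ^ 2 /
        (Nat.multinomial (Finset.univ : Finset (Fin (n + 1))) α : ℝ) : ℝ) : ℂ) := by
  simp only [weylInner, Complex.conj_mul']
  push_cast
  rfl

/-- `weylInner` is a positive definite Hermitian form. -/
abbrev weylCore (n l : ℕ) : InnerProductSpace.Core ℂ (HomogPoly n l) where
  inner := weylInner
  conj_inner_symm p q := by
    simp only [weylInner, map_sum, map_div₀, map_mul, Complex.conj_conj, map_natCast]
    exact Finset.sum_congr rfl fun α _ => by rw [mul_comm]
  re_inner_nonneg p := by
    rw [weylInner_self]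
    simp only [RCLike.re_to_complex, Complex.ofReal_re]
    positivity
  add_left p q r := by
    simp only [weylInner, toPoly_add, MvPolynomial.coeff_add, map_add, add_mul, add_div,
      Finset.sum_add_distrib]
  smul_left p q c := by
    simp only [weylInner, toPoly_smul, MvPolynomial.coeff_smul, smul_eq_mul, map_mul,
      Finset.mul_sum]
    exact Finset.sum_congr rfl fun α _ => by ring
  definite p hp := by
    rw [weylInner_self, Complex.ofReal_eq_zero,
      Finset.sum_eq_zero_iff_of_nonneg (fun α _ => by positivity)] at hp
    refine Subtype.ext (MvPolynomial.ext _ _ fun α => ?_)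
    change p.toPoly.coeff α = MvPolynomial.coeff α 0
    rw [MvPolynomial.coeff_zero]
    by_contra hα
    have hdeg : α.degree = l := by
      rw [Finsupp.degree_eq_weight_one]
      exact p.isHomogeneous hα
    have hmem : α ∈ Finset.finsuppAntidiag (Finset.univ : Finset (Fin (n + 1))) l := by
      rw [Finset.mem_finsuppAntidiag]
      exact ⟨by rw [← hdeg, Finsupp.degree_eq_sum], Finset.subset_univ _⟩
    have h0 := hp α hmem
    have hm : (Nat.multinomial (Finset.univ : Finset (Fin (n + 1))) α : ℝ) ≠ 0 := by
      exact_mod_cast (Nat.multinomial_pos _ _).ne'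
    rw [div_eq_zero_iff, or_iff_left hm] at h0
    exact hα (by simpa using h0)

instance : NormedAddCommGroup (HomogPoly n l) :=
  (weylCore n l).toNormedAddCommGroup

instance : InnerProductSpace ℂ (HomogPoly n l) :=
  InnerProductSpace.ofCore (weylCore n l).toCore

theorem inner_def (p q : HomogPoly n l) : inner ℂ p q = weylInner p q := rfl

end HomogPoly

/-- The space of systems `f = (f₁, …, fₙ)` of homogeneous polynomials in `n + 1` variables of
degrees `d₁, …, dₙ`, with the product of the Bombieri-Weyl Hermitian structures. -/
abbrev PolySystem {n : ℕ} (d : Fin n → ℕ) : Type :=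
  PiLp 2 fun i : Fin n => HomogPoly n (d i)

/-- The maximum of the degrees. -/
def maxDegree {n : ℕ} (d : Fin n → ℕ) : ℕ := Finset.univ.sup d

/-- The polynomial map `ℂⁿ⁺¹ → ℂⁿ` given by a system. -/
def evalSystem {n : ℕ} {d : Fin n → ℕ} (f : PolySystem d) (x : EuclideanSpace ℂ (Fin (n + 1))) :
    EuclideanSpace ℂ (Fin n) :=
  WithLp.toLp 2 fun i => MvPolynomial.eval (fun j => x j) (f i).toPoly

/-! ### The angle in projective space -/

section Angle

variable {E : Type*} [NormedAddCommGroup E] [InnerProductSpace ℂ E]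

/-- The angle between the complex lines spanned by two nonzero vectors. -/
def lineAngle (x y : E) : ℝ := Real.arccos (‖inner ℂ x y‖ / (‖x‖ * ‖y‖))

theorem lineAngle_smul_left {t : ℂ} (ht : t ≠ 0) (x y : E) :
    lineAngle (t • x) y = lineAngle x y := by
  have h : ‖t‖ ≠ 0 := norm_ne_zero_iff.2 ht
  rw [lineAngle, lineAngle, inner_smul_left, norm_mul, norm_smul, RCLike.norm_conj, mul_assoc,
    mul_div_mul_left _ _ h]

theorem lineAngle_comm (x y : E) : lineAngle x y = lineAngle y x := by
  rw [lineAngle, lineAngle, norm_inner_symm, mul_comm]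

/-- The Riemannian distance (the angle) in the projective space of a Hermitian space. -/
def projDist (p q : ℙ ℂ E) : ℝ :=
  Projectivization.lift
    (fun x => Projectivization.lift (fun y => lineAngle (x : E) (y : E))
      (fun a b t h => by
        have ht : t ≠ 0 := by rintro rfl; exact a.2 (by rw [h, zero_smul])
        rw [h, lineAngle_comm, lineAngle_smul_left ht, lineAngle_comm]) q)
    (fun a b t h => by
      have ht : t ≠ 0 := by rintro rfl; exact a.2 (by rw [h, zero_smul])
      simp only [h, lineAngle_smul_left ht]) p

end Angle

/-! ### The normalized condition number -/

/-- The diagonal operator `Δ(a)` on `ℂⁿ`. -/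
def diagOp {n : ℕ} (a : Fin n → ℂ) : EuclideanSpace ℂ (Fin n) →L[ℂ] EuclideanSpace ℂ (Fin n) :=
  Matrix.toEuclideanCLM (n := Fin n) (𝕜 := ℂ) (Matrix.diagonal a)

/-- The restriction of the derivative `Df(x)` to the Hermitian complement of `x`. -/
def restrictedDeriv {n : ℕ} {d : Fin n → ℕ} (f : PolySystem d)
    (x : EuclideanSpace ℂ (Fin (n + 1))) : ↥(ℂ ∙ x)ᗮ →L[ℂ] EuclideanSpace ℂ (Fin n) :=
  (fderiv ℂ (evalSystem f) x).comp (ℂ ∙ x)ᗮ.subtypeL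

open Classical in
/-- The normalized condition number of `f` at `x`, for vectors `f` and `x`: the operator norm
`‖f‖ ‖(Df(x)|_{N_x})⁻¹ Δ(dᵢ^{1/2} ‖x‖^{dᵢ-1})‖`, and `∞` if the inverse does not exist. -/
def muNormVec {n : ℕ} {d : Fin n → ℕ} (f : PolySystem d) (x : EuclideanSpace ℂ (Fin (n + 1))) :
    ℝ≥0∞ :=
  if (restrictedDeriv f x).IsInvertible then
    ENNReal.ofReal (‖f‖ * ‖(restrictedDeriv f x).inverse.comp
      (diagOp fun i => ((√(d i : ℝ) * ‖x‖ ^ (d i - 1) : ℝ) : ℂ))‖)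
  else ⊤

section Invariance

variable {n : ℕ} {d : Fin n → ℕ}

theorem diagOp_apply (a : Fin n → ℂ) (v : EuclideanSpace ℂ (Fin n)) (i : Fin n) :
    diagOp a v i = a i * v i := by
  simp [diagOp, Matrix.mulVec_diagonal]

theorem diagOp_comp (a b : Fin n → ℂ) :
    (diagOp a).comp (diagOp b) = diagOp fun i => a i * b i := by
  ext v i
  simp [diagOp_apply, mul_assoc]

theorem diagOp_one : diagOp (fun _ : Fin n => (1 : ℂ)) = ContinuousLinearMap.id ℂ _ := by
  ext v i
  simp [diagOp_apply]

/-- A diagonal operator with nonzero entries, as an equivalence. -/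
def diagEquiv (a : Fin n → ℂ) (ha : ∀ i, a i ≠ 0) :
    EuclideanSpace ℂ (Fin n) ≃L[ℂ] EuclideanSpace ℂ (Fin n) :=
  ContinuousLinearEquiv.equivOfInverse (diagOp a) (diagOp fun i => (a i)⁻¹)
    (fun v => by ext i; simp [diagOp_apply, ha i])
    (fun v => by ext i; simp [diagOp_apply, ha i])

theorem norm_comp_diagOp_le {F : Type*} [NormedAddCommGroup F] [NormedSpace ℂ F]
    (A : EuclideanSpace ℂ (Fin n) →L[ℂ] F) (u : Fin n → ℂ) (hu : ∀ i, ‖u i‖ = 1) :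
    ‖A.comp (diagOp u)‖ ≤ ‖A‖ := by
  have h : ‖diagOp u‖ ≤ 1 := by
    refine ContinuousLinearMap.opNorm_le_bound _ zero_le_one fun v => ?_
    simp [EuclideanSpace.norm_eq, diagOp_apply, hu]
  calc ‖A.comp (diagOp u)‖ ≤ ‖A‖ * ‖diagOp u‖ := ContinuousLinearMap.opNorm_comp_le _ _
    _ ≤ ‖A‖ * 1 := by gcongr
    _ = ‖A‖ := mul_one _

theorem norm_comp_diagOp {F : Type*} [NormedAddCommGroup F] [NormedSpace ℂ F]
    (A : EuclideanSpace ℂ (Fin n) →L[ℂ] F) (u : Fin n → ℂ) (hu : ∀ i, ‖u i‖ = 1) :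
    ‖A.comp (diagOp u)‖ = ‖A‖ := by
  refine le_antisymm (norm_comp_diagOp_le A u hu) ?_
  have h0 : ∀ i, u i ≠ 0 := fun i h => by simpa [h] using hu i
  have h := norm_comp_diagOp_le (A.comp (diagOp u)) (fun i => (u i)⁻¹) (fun i => by simp [hu i])
  rw [ContinuousLinearMap.comp_assoc, diagOp_comp] at h
  simpa [h0, diagOp_one] using h

theorem norm_smul_op {F : Type*} [NormedAddCommGroup F] [NormedSpace ℂ F] (c : ℂ)
    (A : EuclideanSpace ℂ (Fin n) →L[ℂ] F) : ‖c • A‖ = ‖c‖ * ‖A‖ := norm_smul c A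

theorem evalSystem_smul_system (c : ℂ) (f : PolySystem d) :
    evalSystem (c • f) = c • evalSystem f := by
  ext x i
  simp [evalSystem, HomogPoly.toPoly_smul, MvPolynomial.smul_eval]

theorem evalSystem_smul (f : PolySystem d) (t : ℂ) (x : EuclideanSpace ℂ (Fin (n + 1))) :
    evalSystem f (t • x) = diagOp (fun i => t ^ d i) (evalSystem f x) := by
  ext i
  rw [diagOp_apply]
  simp only [evalSystem, PiLp.smul_apply, smul_eq_mul]
  have h := (f i).isHomogeneous
  rw [MvPolynomial.eval_eq, MvPolynomial.eval_eq, Finset.mul_sum]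
  refine Finset.sum_congr rfl fun α hα => ?_
  have hdeg : α.degree = d i := by
    rw [Finsupp.degree_eq_weight_one]
    exact h (MvPolynomial.mem_support_iff.1 hα)
  simp only [mul_pow, Finset.prod_mul_distrib]
  have hsum : ∑ j ∈ α.support, α j = d i := hdeg
  rw [Finset.prod_pow_eq_pow_sum, hsum]
  ring

theorem fderiv_evalSystem_smul (f : PolySystem d) {t : ℂ} (ht : t ≠ 0)
    (x : EuclideanSpace ℂ (Fin (n + 1))) :
    fderiv ℂ (evalSystem f) (t • x) =
      (diagOp fun i => t⁻¹ * t ^ d i).comp (fderiv ℂ (evalSystem f) x) := by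
  have h1 : (fun y => evalSystem f (t • y)) =
      (diagEquiv (fun i => t ^ d i) fun i => pow_ne_zero _ ht) ∘ evalSystem f := by
    funext y
    exact evalSystem_smul f t y
  have h2 := fderiv_comp_smul (𝕜 := ℂ) (f := evalSystem f) (x := x) t
  rw [h1, ContinuousLinearEquiv.comp_fderiv] at h2
  have h3 : fderiv ℂ (evalSystem f) (t • x) = t⁻¹ • t • fderiv ℂ (evalSystem f) (t • x) := by
    rw [smul_smul, inv_mul_cancel₀ ht, one_smul]
  rw [h3, ← h2]
  ext v i
  simp [diagEquiv, diagOp_apply, mul_assoc]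

theorem muNormVec_smul_left {c : ℂ} (hc : c ≠ 0) (f : PolySystem d)
    (x : EuclideanSpace ℂ (Fin (n + 1))) : muNormVec (c • f) x = muNormVec f x := by
  have h : restrictedDeriv (c • f) x =
      ((diagEquiv (fun _ : Fin n => c) fun _ => hc :
        EuclideanSpace ℂ (Fin n) ≃L[ℂ] EuclideanSpace ℂ (Fin n)) :
        EuclideanSpace ℂ (Fin n) →L[ℂ] EuclideanSpace ℂ (Fin n)).comp (restrictedDeriv f x) := by
    rw [restrictedDeriv, evalSystem_smul_system, fderiv_const_smul_field]
    ext v i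
    simp [restrictedDeriv, diagEquiv, diagOp_apply]
  have hsymm : ((diagEquiv (fun _ : Fin n => c) fun _ => hc).symm :
      EuclideanSpace ℂ (Fin n) →L[ℂ] EuclideanSpace ℂ (Fin n)) =
      c⁻¹ • ContinuousLinearMap.id ℂ (EuclideanSpace ℂ (Fin n)) := by
    ext v i
    exact diagOp_apply _ v i
  have hinv : (restrictedDeriv (c • f) x).inverse = c⁻¹ • (restrictedDeriv f x).inverse := by
    rw [h, ContinuousLinearMap.IsInvertible.inverse_comp_of_left
      ContinuousLinearMap.isInvertible_equiv, ContinuousLinearMap.inverse_equiv, hsymm,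
      ContinuousLinearMap.comp_smul, ContinuousLinearMap.comp_id]
  have hiff : (restrictedDeriv (c • f) x).IsInvertible ↔ (restrictedDeriv f x).IsInvertible := by
    rw [h]
    exact ContinuousLinearMap.isInvertible_equiv_comp
  classical
  have hc' : ‖c‖ ≠ 0 := norm_ne_zero_iff.2 hc
  rw [muNormVec, muNormVec]
  refine if_congr hiff ?_ rfl
  rw [hinv, ContinuousLinearMap.smul_comp, norm_smul c f, norm_smul_op, norm_inv, mul_assoc,
    mul_left_comm ‖f‖, ← mul_assoc, mul_inv_cancel₀ hc', one_mul]

theorem muNormVec_smul_right {t : ℂ} (ht : t ≠ 0) (f : PolySystem d)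
    (x : EuclideanSpace ℂ (Fin (n + 1))) : muNormVec f (t • x) = muNormVec f x := by
  classical
  have hN : (ℂ ∙ (t • x))ᗮ = (ℂ ∙ x)ᗮ := by
    rw [Submodule.span_singleton_smul_eq (IsUnit.mk0 t ht)]
  have key : ∀ (N : Submodule ℂ (EuclideanSpace ℂ (Fin (n + 1)))), N = (ℂ ∙ x)ᗮ →
      (if ((fderiv ℂ (evalSystem f) (t • x)).comp N.subtypeL).IsInvertible then
        ENNReal.ofReal (‖f‖ * ‖((fderiv ℂ (evalSystem f) (t • x)).comp N.subtypeL).inverse.comp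
          (diagOp fun i => ((√(d i : ℝ) * ‖t • x‖ ^ (d i - 1) : ℝ) : ℂ))‖)
      else ⊤) = muNormVec f x := by
    rintro N rfl
    have h : (fderiv ℂ (evalSystem f) (t • x)).comp (ℂ ∙ x)ᗮ.subtypeL =
        ((diagEquiv (fun i => t⁻¹ * t ^ d i)
          fun i => mul_ne_zero (inv_ne_zero ht) (pow_ne_zero _ ht) :
          EuclideanSpace ℂ (Fin n) ≃L[ℂ] EuclideanSpace ℂ (Fin n)) :
          EuclideanSpace ℂ (Fin n) →L[ℂ] EuclideanSpace ℂ (Fin n)).comp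
          (restrictedDeriv f x) := by
      rw [fderiv_evalSystem_smul f ht, restrictedDeriv]
      rfl
    have hsymm : ((diagEquiv (fun i => t⁻¹ * t ^ d i)
          fun i => mul_ne_zero (inv_ne_zero ht) (pow_ne_zero _ ht)).symm :
          EuclideanSpace ℂ (Fin n) →L[ℂ] EuclideanSpace ℂ (Fin n)) =
        diagOp fun i => (t⁻¹ * t ^ d i)⁻¹ := rfl
    have hu : ∀ i : Fin n, ‖((‖t‖ : ℂ) / t) ^ (d i - 1)‖ = 1 := fun i => by
      simp [ht]
    have hdiag : (diagOp fun i => (t⁻¹ * t ^ d i)⁻¹).comp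
          (diagOp fun i => ((√(d i : ℝ) * ‖t • x‖ ^ (d i - 1) : ℝ) : ℂ)) =
        (diagOp fun i => ((√(d i : ℝ) * ‖x‖ ^ (d i - 1) : ℝ) : ℂ)).comp
          (diagOp fun i => ((‖t‖ : ℂ) / t) ^ (d i - 1)) := by
      rw [diagOp_comp, diagOp_comp]
      congr 1
      funext i
      rcases Nat.eq_zero_or_pos (d i) with h0 | h0
      · simp [h0]
      · obtain ⟨k, hk⟩ := Nat.exists_eq_add_of_le' h0
        rw [hk, norm_smul]
        push_cast
        field_simp
        rw [div_pow, mul_pow]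
        field_simp
        ring
    rw [h, muNormVec]
    refine if_congr ContinuousLinearMap.isInvertible_equiv_comp ?_ rfl
    rw [ContinuousLinearMap.IsInvertible.inverse_comp_of_left
      ContinuousLinearMap.isInvertible_equiv, ContinuousLinearMap.inverse_equiv, hsymm,
      ContinuousLinearMap.comp_assoc, hdiag, ← ContinuousLinearMap.comp_assoc,
      norm_comp_diagOp _ _ hu]
  have h := key _ hN
  rw [← h]
  rfl

end Invariance

/-- The normalized condition number on `ℙ(ℋ_(d)) × ℙ(ℂⁿ⁺¹)`. -/
def muNorm {n : ℕ} {d : Fin n → ℕ} (f : ℙ ℂ (PolySystem d))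
    (x : ℙ ℂ (EuclideanSpace ℂ (Fin (n + 1)))) : ℝ≥0∞ :=
  Projectivization.lift
    (fun g => Projectivization.lift
      (fun y => muNormVec (g : PolySystem d) (y : EuclideanSpace ℂ (Fin (n + 1))))
      (fun a b t h => by
        have ht : t ≠ 0 := by rintro rfl; exact a.2 (by rw [h, zero_smul])
        rw [h, muNormVec_smul_right ht]) x)
    (fun a b t h => by
      have ht : t ≠ 0 := by rintro rfl; exact a.2 (by rw [h, zero_smul])
      simp only [h, muNormVec_smul_left ht]) f

end Bezout

end

/-! For unit representatives, write `scaledDeriv f x` for Δ(dᵢ^{-1/2}) Df(x). Then μ_norm(f, x) is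
the norm of the inverse of its restriction to x^⊥, so 1/μ_norm(f, x) is the largest c with c‖v‖ ≤
‖`scaledDeriv f x v`‖ on x^⊥ (`ExpandsBy`), a smallest singular value. The theorem says that this
quantity is Lipschitz in (f, x), with dimension-free constants: |1/μ_norm(f, x) - 1/μ_norm(g, y)| ≤
e² (D^{1/2} ‖f - g‖ + 3 D^{3/2} ‖x - y‖). When the right side is at most τ/μ_norm(f, x) with τ < 1,
the two condition numbers differ by a factor close to one.

The analytic input is that evaluation at x has norm at most ‖x‖^l in the Bombieri-Weyl structure.
Cauchy estimates on circles of radius 1/l, where ‖x‖^l grows only by a bounded factor, then bound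
the first derivative by l e²‖p‖ and its Lipschitz constant by l² e²‖p‖. Division by dᵢ^{1/2} turns
these into D^{1/2} and D^{3/2}. `ExpandsBy.perturb` combines them with the rotation from x^⊥ to y^⊥;
`muNormVec_perturb` applies it in both directions. Finally, unit representatives with suitable
phases have ‖u - v‖ at most the angle. -/

noncomputable section

namespace Bezout

/-! ### Pointwise estimates for homogeneous polynomials -/

namespace HomogPoly

variable {n l : ℕ}

/-- The polynomial function on `ℂⁿ⁺¹` given by a homogeneous polynomial. -/
def toFun (p : HomogPoly n l) (x : EuclideanSpace ℂ (Fin (n + 1))) : ℂ :=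
  MvPolynomial.eval (fun j => x j) p.toPoly

theorem toFun_eq_sum (p : HomogPoly n l) (x : EuclideanSpace ℂ (Fin (n + 1))) :
    p.toFun x = ∑ α ∈ Finset.finsuppAntidiag (Finset.univ : Finset (Fin (n + 1))) l,
      p.toPoly.coeff α * ∏ j, x j ^ α j := by
  rw [toFun, MvPolynomial.eval_eq']
  refine Finset.sum_subset (fun α hα => ?_) fun α _ hα => ?_
  · have hdeg : α.degree = l := by
      rw [Finsupp.degree_eq_weight_one]
      exact p.isHomogeneous (MvPolynomial.mem_support_iff.1 hα)
    rw [Finset.mem_finsuppAntidiag]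
    exact ⟨by rw [← hdeg, Finsupp.degree_eq_sum], Finset.subset_univ _⟩
  · rw [MvPolynomial.notMem_support_iff.1 hα, zero_mul]

theorem norm_sq_eq_sum (p : HomogPoly n l) :
    ‖p‖ ^ 2 = ∑ α ∈ Finset.finsuppAntidiag (Finset.univ : Finset (Fin (n + 1))) l,
      ‖p.toPoly.coeff α‖ ^ 2 /
        (Nat.multinomial (Finset.univ : Finset (Fin (n + 1))) α : ℝ) := by
  have h := inner_self_eq_norm_sq_to_K (𝕜 := ℂ) p
  rw [inner_def, weylInner_self] at h
  exact (Complex.ofReal_injective (by simpa using h)).symm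

/-- The multinomial theorem, transferred from function-valued to finitely supported multi-indices.
-/
theorem sum_finsuppAntidiag_multinomial (a : Fin (n + 1) → ℝ) (l : ℕ) :
    ∑ α ∈ Finset.finsuppAntidiag (Finset.univ : Finset (Fin (n + 1))) l,
      (Nat.multinomial (Finset.univ : Finset (Fin (n + 1))) α : ℝ) * ∏ j, a j ^ α j =
      (∑ j, a j) ^ l := by
  rw [Finset.sum_pow_eq_sum_piAntidiag, Finset.finsuppAntidiag, Finset.sum_map,
    ← Finset.sum_attach (Finset.piAntidiag _ _)]
  rfl

/-- The evaluation at `x` has norm at most `‖x‖ ^ l`. -/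
theorem norm_toFun_le (p : HomogPoly n l) (x : EuclideanSpace ℂ (Fin (n + 1))) :
    ‖p.toFun x‖ ≤ ‖p‖ * ‖x‖ ^ l := by
  refine le_of_sq_le_sq ?_ (by positivity)
  have hm : ∀ α : Fin (n + 1) →₀ ℕ,
      (Nat.multinomial (Finset.univ : Finset (Fin (n + 1))) α : ℝ) ≠ 0 := fun α => by
    exact_mod_cast (Nat.multinomial_pos _ _).ne'
  calc ‖p.toFun x‖ ^ 2
      ≤ (∑ α ∈ Finset.finsuppAntidiag (Finset.univ : Finset (Fin (n + 1))) l,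
          ‖p.toPoly.coeff α * ∏ j, x j ^ α j‖) ^ 2 := by
        rw [toFun_eq_sum]
        gcongr
        exact norm_sum_le _ _
    _ ≤ (∑ α ∈ Finset.finsuppAntidiag (Finset.univ : Finset (Fin (n + 1))) l,
          ‖p.toPoly.coeff α‖ ^ 2 /
            (Nat.multinomial (Finset.univ : Finset (Fin (n + 1))) α : ℝ)) *
        ∑ α ∈ Finset.finsuppAntidiag (Finset.univ : Finset (Fin (n + 1))) l,
          (Nat.multinomial (Finset.univ : Finset (Fin (n + 1))) α : ℝ) *
            ∏ j, (‖x j‖ ^ 2) ^ α j := by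
        -- Cauchy-Schwarz with the multinomial weights: the first factor is the squared Weyl norm,
        -- the second sums to ‖x‖^{2l}.
        refine Finset.sum_sq_le_sum_mul_sum_of_sq_le_mul _ (fun α _ => by positivity)
          (fun α _ => by positivity) fun α _ => le_of_eq ?_
        rw [norm_mul, norm_prod, mul_pow, ← Finset.prod_pow, div_mul_eq_mul_div, ← mul_assoc,
          mul_comm _ (Nat.multinomial _ _ : ℝ), mul_assoc, mul_div_cancel_left₀ _ (hm α)]
        simp only [norm_pow, ← pow_mul, mul_comm]
    _ = (‖p‖ * ‖x‖ ^ l) ^ 2 := by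
        rw [← norm_sq_eq_sum, sum_finsuppAntidiag_multinomial, ← EuclideanSpace.norm_sq_eq]
        ring

/-! ### Cauchy estimates for the derivative -/

theorem differentiable_toFun (p : HomogPoly n l) : Differentiable ℂ p.toFun := by
  have h : p.toFun = fun x => ∑ α ∈ Finset.finsuppAntidiag (Finset.univ : Finset (Fin (n + 1))) l,
      p.toPoly.coeff α * ∏ j, x j ^ α j := funext p.toFun_eq_sum
  rw [h]
  fun_prop

theorem hasDerivAt_line (p : HomogPoly n l) (x w : EuclideanSpace ℂ (Fin (n + 1))) (t : ℂ) :
    HasDerivAt (fun s : ℂ => p.toFun (x + s • w)) (fderiv ℂ p.toFun (x + t • w) w) t := by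
  have h1 : HasDerivAt (fun s : ℂ => x + s • w) w t := by
    simpa using ((hasDerivAt_id t).smul_const w).const_add x
  exact (p.differentiable_toFun _).hasFDerivAt.comp_hasDerivAt t h1

theorem one_add_div_pow_le_exp (a : ℝ) (ha : 0 ≤ a) (hl : 1 ≤ l) :
    (1 + a / l) ^ l ≤ Real.exp a := by
  have hl' : (l : ℝ) ≠ 0 := by positivity
  calc (1 + a / l) ^ l ≤ Real.exp (a / l) ^ l := by
        gcongr
        rw [add_comm]
        exact Real.add_one_le_exp _
    _ = Real.exp a := by rw [← Real.exp_nat_mul, mul_div_cancel₀ _ hl']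

/-- Cauchy estimate for the first derivative slightly outside of the unit ball. -/
theorem norm_fderiv_le (hl : 1 ≤ l) (p : HomogPoly n l) {x : EuclideanSpace ℂ (Fin (n + 1))}
    (hx : ‖x‖ ≤ 1 + 1 / l) : ‖fderiv ℂ p.toFun x‖ ≤ l * (Real.exp 2 * ‖p‖) := by
  have hl' : (0 : ℝ) < l := by positivity
  have hunit : ∀ w : EuclideanSpace ℂ (Fin (n + 1)), ‖w‖ = 1 →
      ‖fderiv ℂ p.toFun x w‖ ≤ l * (Real.exp 2 * ‖p‖) := fun w hw => by
    -- On the circle of radius 1/l in direction w the points have norm at most 1 + 2/l, and (1 +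
    -- 2/l)^l ≤ e². Dividing by the radius gives the factor l.
    have h := Complex.norm_deriv_le_of_forall_mem_sphere_norm_le (c := 0) (R := 1 / l)
      (C := Real.exp 2 * ‖p‖) (f := fun s : ℂ => p.toFun (x + s • w)) (by positivity)
      (Differentiable.diffContOnCl fun t => (p.hasDerivAt_line x w t).differentiableAt)
      fun z hz => by
        rw [mem_sphere_zero_iff_norm] at hz
        have hz' : ‖x + z • w‖ ≤ 1 + 2 / l := by
          refine (norm_add_le _ _).trans ?_
          rw [norm_smul, hz, hw, mul_one]
          calc ‖x‖ + 1 / l ≤ 1 + 1 / l + 1 / l := by gcongr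
            _ = 1 + 2 / l := by ring
        calc ‖p.toFun (x + z • w)‖ ≤ ‖p‖ * ‖x + z • w‖ ^ l := p.norm_toFun_le _
          _ ≤ ‖p‖ * (1 + 2 / l) ^ l := by gcongr
          _ ≤ ‖p‖ * Real.exp 2 := by
            gcongr
            exact one_add_div_pow_le_exp 2 (by norm_num) hl
          _ = Real.exp 2 * ‖p‖ := mul_comm _ _
    rw [(p.hasDerivAt_line x w 0).deriv, zero_smul, add_zero] at h
    refine h.trans_eq ?_
    field_simp
  exact ContinuousLinearMap.opNorm_le_of_unit_norm (by positivity) hunit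

/-- Lipschitz estimate for the first derivative on the unit ball. -/
theorem norm_fderiv_sub_le (hl : 1 ≤ l) (p : HomogPoly n l)
    {x y : EuclideanSpace ℂ (Fin (n + 1))} (hx : ‖x‖ ≤ 1) (hy : ‖y‖ ≤ 1) :
    ‖fderiv ℂ p.toFun x - fderiv ℂ p.toFun y‖ ≤ l ^ 2 * (Real.exp 2 * ‖p‖) * ‖x - y‖ := by
  have hl' : (0 : ℝ) < l := by positivity
  refine ContinuousLinearMap.opNorm_le_of_unit_norm (by positivity) fun w hw => ?_
  have hball : ∀ z : ℂ, ‖z‖ = 1 / l → ∀ u : EuclideanSpace ℂ (Fin (n + 1)), ‖u‖ ≤ 1 →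
      u + z • w ∈ Metric.closedBall (0 : EuclideanSpace ℂ (Fin (n + 1))) (1 + 1 / l) :=
    fun z hz u hu => by
      rw [mem_closedBall_zero_iff]
      refine (norm_add_le _ _).trans ?_
      rw [norm_smul, hz, hw, mul_one]
      gcongr
  -- Cauchy's estimate for the difference of p along the parallel lines through x and y: its
  -- derivative at 0 is the difference of the derivatives. On the circle both points lie in the ball
  -- of radius 1 + 1/l, where the mean value inequality applies; this is why `norm_fderiv_le`
  -- reaches beyond the unit ball.
  have h := Complex.norm_deriv_le_of_forall_mem_sphere_norm_le (c := 0) (R := 1 / l)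
    (C := l * (Real.exp 2 * ‖p‖) * ‖x - y‖)
    (f := fun s : ℂ => p.toFun (x + s • w) - p.toFun (y + s • w)) (by positivity)
    (Differentiable.diffContOnCl fun t =>
      ((p.hasDerivAt_line x w t).sub (p.hasDerivAt_line y w t)).differentiableAt)
    fun z hz => by
      rw [mem_sphere_zero_iff_norm] at hz
      have h1 := Convex.norm_image_sub_le_of_norm_fderiv_le (𝕜 := ℂ)
        (fun u _ => p.differentiable_toFun u)
        (fun u hu => p.norm_fderiv_le hl (mem_closedBall_zero_iff.1 hu))
        (convex_closedBall (0 : EuclideanSpace ℂ (Fin (n + 1))) (1 + 1 / (l : ℝ)))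
        (hball z hz y hy) (hball z hz x hx)
      rwa [add_sub_add_right_eq_sub] at h1
  rw [HasDerivAt.deriv (f := fun s : ℂ => p.toFun (x + s • w) - p.toFun (y + s • w))
    ((p.hasDerivAt_line x w 0).sub (p.hasDerivAt_line y w 0)), zero_smul, add_zero,
    add_zero] at h
  refine h.trans_eq ?_
  field_simp

end HomogPoly

/-! ### The scaled derivative of a system -/

section ScaledDeriv

variable {n : ℕ} {d : Fin n → ℕ}

/-- Both norms are ℓ² over the equations, so componentwise bounds add up without a factor depending
on n. -/
theorem norm_le_mul_norm_system (f : PolySystem d) (u : EuclideanSpace ℂ (Fin n)) {c : ℝ}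
    (hc : 0 ≤ c) (h : ∀ i, ‖u i‖ ≤ c * ‖f i‖) : ‖u‖ ≤ c * ‖f‖ := by
  refine le_of_sq_le_sq ?_ (by positivity)
  rw [mul_pow, EuclideanSpace.norm_sq_eq, PiLp.norm_sq_eq_of_L2, Finset.mul_sum]
  refine Finset.sum_le_sum fun i _ => ?_
  rw [← mul_pow]
  exact pow_le_pow_left₀ (norm_nonneg _) (h i) 2

/-- The derivative of `f` at `x`, with the `i`-th component divided by `dᵢ^{1/2}`. -/
def scaledDeriv (f : PolySystem d) (x : EuclideanSpace ℂ (Fin (n + 1))) :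
    EuclideanSpace ℂ (Fin (n + 1)) →L[ℂ] EuclideanSpace ℂ (Fin n) :=
  (diagOp fun i => (((√(d i : ℝ))⁻¹ : ℝ) : ℂ)).comp (fderiv ℂ (evalSystem f) x)

theorem differentiable_evalSystem (f : PolySystem d) : Differentiable ℂ (evalSystem f) :=
  (differentiable_euclidean (𝕜 := ℂ)).2 fun i => (f i).differentiable_toFun

theorem fderiv_evalSystem_apply (f : PolySystem d) (x v : EuclideanSpace ℂ (Fin (n + 1)))
    (i : Fin n) : fderiv ℂ (evalSystem f) x v i = fderiv ℂ (f i).toFun x v := by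
  have h : HasFDerivAt (f i).toFun
      ((EuclideanSpace.proj i : EuclideanSpace ℂ (Fin n) →L[ℂ] ℂ).comp
        (fderiv ℂ (evalSystem f) x)) x :=
    (EuclideanSpace.proj i : EuclideanSpace ℂ (Fin n) →L[ℂ] ℂ).hasFDerivAt.comp x
      (differentiable_evalSystem f x).hasFDerivAt
  rw [h.fderiv]
  rfl

theorem scaledDeriv_apply (f : PolySystem d) (x v : EuclideanSpace ℂ (Fin (n + 1))) (i : Fin n) :
    scaledDeriv f x v i = (((√(d i : ℝ))⁻¹ : ℝ) : ℂ) * fderiv ℂ (f i).toFun x v := by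
  rw [← fderiv_evalSystem_apply, scaledDeriv, ContinuousLinearMap.comp_apply, diagOp_apply]

theorem scaledDeriv_sub (f g : PolySystem d) (x : EuclideanSpace ℂ (Fin (n + 1))) :
    scaledDeriv (f - g) x = scaledDeriv f x - scaledDeriv g x := by
  have h : evalSystem (f - g) = evalSystem f - evalSystem g := by
    funext x
    ext i
    exact (MvPolynomial.eval fun j => x j).map_sub (f i).toPoly (g i).toPoly
  rw [scaledDeriv, h, fderiv_sub (differentiable_evalSystem f x) (differentiable_evalSystem g x),
    ContinuousLinearMap.comp_sub]
  rfl

theorem degree_le_maxDegree (d : Fin n → ℕ) (i : Fin n) : (d i : ℝ) ≤ maxDegree d := by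
  exact_mod_cast Finset.le_sup (f := d) (Finset.mem_univ i)

theorem inv_sqrt_mul_self (a : ℝ) : (√a)⁻¹ * a = √a := by
  rw [inv_mul_eq_div, Real.div_sqrt]

theorem norm_scaledDeriv_apply_le (hd : ∀ i, 1 ≤ d i) (f : PolySystem d)
    {x : EuclideanSpace ℂ (Fin (n + 1))} (hx : ‖x‖ ≤ 1) (v : EuclideanSpace ℂ (Fin (n + 1))) :
    ‖scaledDeriv f x v‖ ≤ Real.exp 2 * √(maxDegree d) * ‖v‖ * ‖f‖ := by
  refine norm_le_mul_norm_system f _ (by positivity) fun i => ?_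
  have hx' : ‖x‖ ≤ 1 + 1 / (d i : ℝ) := hx.trans (le_add_of_nonneg_right (by positivity))
  rw [scaledDeriv_apply, norm_mul, Complex.norm_real, Real.norm_of_nonneg (by positivity)]
  calc (√(d i : ℝ))⁻¹ * ‖fderiv ℂ (f i).toFun x v‖
      ≤ (√(d i : ℝ))⁻¹ * ((d i * (Real.exp 2 * ‖f i‖)) * ‖v‖) := by
        gcongr
        exact ContinuousLinearMap.le_of_opNorm_le _ ((f i).norm_fderiv_le (hd i) hx') v
    _ = Real.exp 2 * ((√(d i : ℝ))⁻¹ * d i) * ‖v‖ * ‖f i‖ := by ring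
    _ ≤ Real.exp 2 * √(maxDegree d) * ‖v‖ * ‖f i‖ := by
        rw [inv_sqrt_mul_self]
        gcongr
        exact_mod_cast degree_le_maxDegree d i

theorem norm_scaledDeriv_apply_sub_le (hd : ∀ i, 1 ≤ d i) (f : PolySystem d)
    {x y : EuclideanSpace ℂ (Fin (n + 1))} (hx : ‖x‖ ≤ 1) (hy : ‖y‖ ≤ 1)
    (v : EuclideanSpace ℂ (Fin (n + 1))) :
    ‖scaledDeriv f x v - scaledDeriv f y v‖ ≤
      Real.exp 2 * (maxDegree d * √(maxDegree d)) * ‖x - y‖ * ‖v‖ * ‖f‖ := by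
  refine norm_le_mul_norm_system f _ (by positivity) fun i => ?_
  rw [PiLp.sub_apply, scaledDeriv_apply, scaledDeriv_apply, ← mul_sub, norm_mul,
    Complex.norm_real, Real.norm_of_nonneg (by positivity), ← sub_apply]
  calc (√(d i : ℝ))⁻¹ * ‖(fderiv ℂ (f i).toFun x - fderiv ℂ (f i).toFun y) v‖
      ≤ (√(d i : ℝ))⁻¹ * ((d i ^ 2 * (Real.exp 2 * ‖f i‖) * ‖x - y‖) * ‖v‖) := by
        gcongr
        exact ContinuousLinearMap.le_of_opNorm_le _ ((f i).norm_fderiv_sub_le (hd i) hx hy) v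
    _ = Real.exp 2 * (d i * ((√(d i : ℝ))⁻¹ * d i)) * ‖x - y‖ * ‖v‖ * ‖f i‖ := by ring
    _ ≤ Real.exp 2 * (maxDegree d * √(maxDegree d)) * ‖x - y‖ * ‖v‖ * ‖f i‖ := by
        rw [inv_sqrt_mul_self]
        gcongr
        · exact_mod_cast degree_le_maxDegree d i
        · exact_mod_cast degree_le_maxDegree d i

/-- The scaled derivative of `f` at `x` expands the Hermitian complement of `x` by at
least `c`. -/
def ExpandsBy (f : PolySystem d) (x : EuclideanSpace ℂ (Fin (n + 1))) (c : ℝ) : Prop :=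
  ∀ v ∈ (ℂ ∙ x)ᗮ, c * ‖v‖ ≤ ‖scaledDeriv f x v‖

/-- For n = 0 the space of systems is zero and its projective space is empty, so this degenerate
case never arises. -/
theorem pos_of_system_ne_zero {f : PolySystem d} (hf : f ≠ 0) : 0 < n := by
  rcases Nat.eq_zero_or_pos n with rfl | h
  · exact absurd (Subsingleton.elim f 0) hf
  · exact h

theorem finrank_complement {x : EuclideanSpace ℂ (Fin (n + 1))} (hx : x ≠ 0) :
    Module.finrank ℂ ↥(ℂ ∙ x)ᗮ = n :=
  haveI : Fact (Module.finrank ℂ (EuclideanSpace ℂ (Fin (n + 1))) = n + 1) := ⟨by simp⟩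
  Submodule.finrank_orthogonal_span_singleton hx

theorem exists_mem_complement_ne_zero {f : PolySystem d} (hf : f ≠ 0)
    {x : EuclideanSpace ℂ (Fin (n + 1))} (hx : x ≠ 0) : ∃ v ∈ (ℂ ∙ x)ᗮ, v ≠ 0 := by
  refine Submodule.exists_mem_ne_zero_of_ne_bot fun h => ?_
  have h1 := finrank_complement hx
  rw [h, finrank_bot] at h1
  exact (pos_of_system_ne_zero hf).ne h1

/-- A nonzero vector of x^⊥ compares the expansion constant with the upper bound for the scaled
derivative. In the perturbation argument this absorbs a term c‖x - y‖. -/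
theorem ExpandsBy.le (hd : ∀ i, 1 ≤ d i) {f : PolySystem d} (hf : ‖f‖ = 1)
    {x : EuclideanSpace ℂ (Fin (n + 1))} (hx : ‖x‖ = 1) {c : ℝ} (h : ExpandsBy f x c) :
    c ≤ Real.exp 2 * √(maxDegree d) := by
  obtain ⟨v, hv, hv0⟩ := exists_mem_complement_ne_zero (f := f) (x := x)
    (norm_ne_zero_iff.1 (by simp [hf])) (norm_ne_zero_iff.1 (by simp [hx]))
  have h1 := (h v hv).trans (norm_scaledDeriv_apply_le hd f hx.le v)
  rw [hf, mul_one] at h1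
  exact le_of_mul_le_mul_right h1 (norm_pos_iff.2 hv0)

theorem one_le_maxDegree (hd : ∀ i, 1 ≤ d i) {f : PolySystem d} (hf : f ≠ 0) :
    (1 : ℝ) ≤ maxDegree d :=
  le_trans (by exact_mod_cast hd _) (degree_le_maxDegree d ⟨0, pos_of_system_ne_zero hf⟩)

/-- Perturbation of the expansion constant of the scaled derivative. -/
theorem ExpandsBy.perturb (hd : ∀ i, 1 ≤ d i) {f : PolySystem d} (g : PolySystem d)
    (hf : ‖f‖ = 1) {x y : EuclideanSpace ℂ (Fin (n + 1))} (hx : ‖x‖ = 1) (hy : ‖y‖ = 1)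
    {c : ℝ} (hc : 0 ≤ c) (h : ExpandsBy f x c) :
    ExpandsBy g y (c - Real.exp 2 * (√(maxDegree d) * ‖f - g‖ +
      3 * (maxDegree d * √(maxDegree d) * ‖x - y‖))) := by
  intro w hw
  have hcle := h.le hd hf hx
  have hD := one_le_maxDegree hd (f := f) (norm_ne_zero_iff.1 (by simp [hf]))
  set D : ℝ := (maxDegree d : ℝ)
  have hDs : √D ≤ D * √D := le_mul_of_one_le_left (by positivity) hD
  -- w is orthogonal to y, not to x, but its component along x is of order ‖x - y‖. Removing it
  -- gives a vector of x^⊥ to which the hypothesis applies.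
  have hin : ‖(inner ℂ x w : ℂ)‖ ≤ ‖x - y‖ * ‖w‖ := by
    have h0 : inner ℂ y w = (0 : ℂ) := Submodule.mem_orthogonal_singleton_iff_inner_right.1 hw
    have h1 : inner ℂ x w = (inner ℂ (x - y) w : ℂ) := by rw [inner_sub_left, h0, sub_zero]
    rw [h1]
    exact norm_inner_le_norm _ _
  set a : ℂ := inner ℂ x w
  have hproj : w - a • x ∈ (ℂ ∙ x)ᗮ := by
    rw [Submodule.mem_orthogonal_singleton_iff_inner_right, inner_sub_right, inner_smul_right,
      inner_self_eq_norm_sq_to_K, hx]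
    simp [a]
  have hax : ‖a • x‖ ≤ ‖x - y‖ * ‖w‖ := by rwa [norm_smul, hx, mul_one]
  have h1 := h _ hproj
  have h2 : ‖w‖ - ‖x - y‖ * ‖w‖ ≤ ‖w - a • x‖ := by
    linarith [norm_sub_norm_le w (a • x)]
  have h3 : ‖scaledDeriv f x (a • x)‖ ≤ Real.exp 2 * √D * (‖x - y‖ * ‖w‖) := by
    refine (norm_scaledDeriv_apply_le hd f hx.le _).trans ?_
    rw [hf, mul_one]
    gcongr
  have h4 := norm_scaledDeriv_apply_sub_le hd f hx.le hy.le w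
  have h5 : ‖scaledDeriv f y w - scaledDeriv g y w‖ ≤ Real.exp 2 * √D * ‖w‖ * ‖f - g‖ := by
    have := norm_scaledDeriv_apply_le hd (f - g) hy.le w
    rwa [scaledDeriv_sub] at this
  have h6 : ‖scaledDeriv f x (w - a • x)‖ ≤ ‖scaledDeriv g y w‖ +
      ‖scaledDeriv f y w - scaledDeriv g y w‖ + ‖scaledDeriv f x w - scaledDeriv f y w‖ +
      ‖scaledDeriv f x (a • x)‖ := by
    have e : scaledDeriv f x (w - a • x) = scaledDeriv g y w +
        (scaledDeriv f y w - scaledDeriv g y w) + (scaledDeriv f x w - scaledDeriv f y w) -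
        scaledDeriv f x (a • x) := by
      rw [map_sub]
      abel
    rw [e]
    refine (norm_sub_le _ _).trans ?_
    gcongr
    exact norm_add₃_le
  have h7 : c * (‖w‖ - ‖x - y‖ * ‖w‖) ≤ c * ‖w - a • x‖ := by gcongr
  have h8 : c * (‖x - y‖ * ‖w‖) ≤ Real.exp 2 * √D * (‖x - y‖ * ‖w‖) := by gcongr
  -- The factor 3 counts the errors in ‖x - y‖: the change of the derivative (`h4`), the removed
  -- component (`h3`) and the loss of length of w (`h8`). The last two are only of order √D and are
  -- weakened to D√D.
  have h9 : Real.exp 2 * √D * (‖x - y‖ * ‖w‖) ≤ Real.exp 2 * (D * √D) * (‖x - y‖ * ‖w‖) := by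
    gcongr
  rw [hf, mul_one] at h4
  linarith

/-! ### The condition number as an inverse expansion constant -/

theorem restrictedDeriv_apply (hd : ∀ i, 1 ≤ d i) (f : PolySystem d)
    (x : EuclideanSpace ℂ (Fin (n + 1))) (v : ↥(ℂ ∙ x)ᗮ) :
    restrictedDeriv f x v = diagOp (fun i => ((√(d i : ℝ) : ℝ) : ℂ)) (scaledDeriv f x v) := by
  ext i
  have : (√(d i : ℝ) : ℝ) ≠ 0 := by
    have := hd i
    positivity
  rw [diagOp_apply, scaledDeriv_apply, ← fderiv_evalSystem_apply, ← mul_assoc,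
    ← Complex.ofReal_mul, mul_inv_cancel₀ this, Complex.ofReal_one, one_mul]
  rfl

theorem diagOp_scaling (x : EuclideanSpace ℂ (Fin (n + 1))) (hx : ‖x‖ = 1) :
    (diagOp fun i => ((√(d i : ℝ) * ‖x‖ ^ (d i - 1) : ℝ) : ℂ)) =
      diagOp fun i => ((√(d i : ℝ) : ℝ) : ℂ) := by
  simp [hx]

/-- Expansion makes the restricted derivative injective, hence invertible since both spaces have
dimension n. The entries √dᵢ of Δ cancel the scaling, leaving the inverse of the scaled derivative,
of norm at most 1/c. -/
theorem ExpandsBy.muNormVec_le (hd : ∀ i, 1 ≤ d i) {f : PolySystem d} (hf : ‖f‖ = 1)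
    {x : EuclideanSpace ℂ (Fin (n + 1))} (hx : ‖x‖ = 1) {c : ℝ} (hc : 0 < c)
    (h : ExpandsBy f x c) : muNormVec f x ≤ ENNReal.ofReal (1 / c) := by
  have hs : ∀ i, ((√(d i : ℝ) : ℝ) : ℂ) ≠ 0 := fun i => by
    have := hd i
    exact_mod_cast (Real.sqrt_pos.2 (by positivity)).ne'
  set S := diagEquiv _ hs
  have hS : ∀ v : ↥(ℂ ∙ x)ᗮ, restrictedDeriv f x v = S (scaledDeriv f x v) :=
    restrictedDeriv_apply hd f x
  have hinj : Function.Injective (restrictedDeriv f x) := by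
    refine (injective_iff_map_eq_zero _).2 fun v hv => ?_
    rw [hS, map_eq_zero_iff _ S.injective] at hv
    have h1 := h v v.2
    rw [hv, norm_zero] at h1
    have h2 : ‖(v : EuclideanSpace ℂ (Fin (n + 1)))‖ ≤ 0 := nonpos_of_mul_nonpos_right h1 hc
    exact Subtype.ext (norm_le_zero_iff.1 h2)
  have hfin : Module.finrank ℂ ↥(ℂ ∙ x)ᗮ = Module.finrank ℂ (EuclideanSpace ℂ (Fin n)) := by
    rw [finrank_complement (norm_ne_zero_iff.1 (by simp [hx])), finrank_euclideanSpace_fin]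
  set e : ↥(ℂ ∙ x)ᗮ ≃L[ℂ] EuclideanSpace ℂ (Fin n) :=
    (LinearEquiv.ofInjectiveOfFinrankEq (restrictedDeriv f x : ↥(ℂ ∙ x)ᗮ →ₗ[ℂ] _)
      hinj hfin).toContinuousLinearEquiv
  have he : restrictedDeriv f x = (e : ↥(ℂ ∙ x)ᗮ →L[ℂ] EuclideanSpace ℂ (Fin n)) := by
    ext v
    rfl
  rw [muNormVec, if_pos ⟨e, he.symm⟩, hf, one_mul, diagOp_scaling x hx, he,
    ContinuousLinearMap.inverse_equiv]
  refine ENNReal.ofReal_le_ofReal (ContinuousLinearMap.opNorm_le_bound _ (by positivity)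
    fun v => ?_)
  have h1 : restrictedDeriv f x (e.symm (S v)) = S v := by
    rw [he]
    exact e.apply_symm_apply _
  rw [hS] at h1
  have h2 := h _ (e.symm (S v)).2
  rw [S.injective h1] at h2
  rw [one_div, inv_mul_eq_div, le_div_iff₀' hc]
  exact h2

/-- The converse: v is recovered by applying the inverse composed with Δ to its scaled derivative. A
finite bound excludes the non-invertible case. -/
theorem norm_le_of_muNormVec_le (hd : ∀ i, 1 ≤ d i) {f : PolySystem d} (hf : ‖f‖ = 1)
    {x : EuclideanSpace ℂ (Fin (n + 1))} (hx : ‖x‖ = 1) {m : ℝ} (hm : 0 ≤ m)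
    (h : muNormVec f x ≤ ENNReal.ofReal m) {v : EuclideanSpace ℂ (Fin (n + 1))}
    (hv : v ∈ (ℂ ∙ x)ᗮ) : ‖v‖ ≤ m * ‖scaledDeriv f x v‖ := by
  rw [muNormVec] at h
  split_ifs at h with hinv
  · rw [hf, one_mul, diagOp_scaling x hx, ENNReal.ofReal_le_ofReal_iff hm] at h
    have h1 := ContinuousLinearMap.le_of_opNorm_le _ h (scaledDeriv f x v)
    rw [ContinuousLinearMap.comp_apply, ← restrictedDeriv_apply hd f x ⟨v, hv⟩] at h1
    rwa [hinv.inverse_apply_self] at h1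
  · simp at h

theorem muNormVec_ne_zero (hd : ∀ i, 1 ≤ d i) {f : PolySystem d} (hf : ‖f‖ = 1)
    {x : EuclideanSpace ℂ (Fin (n + 1))} (hx : ‖x‖ = 1) : muNormVec f x ≠ 0 := fun h => by
  obtain ⟨v, hv, hv0⟩ := exists_mem_complement_ne_zero (f := f) (x := x)
    (norm_ne_zero_iff.1 (by simp [hf])) (norm_ne_zero_iff.1 (by simp [hx]))
  have h1 := norm_le_of_muNormVec_le (m := 0) hd hf hx le_rfl (by simp [h]) hv
  rw [zero_mul] at h1
  exact hv0 (norm_le_zero_iff.1 h1)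

theorem expandsBy_of_muNormVec_le (hd : ∀ i, 1 ≤ d i) {f : PolySystem d} (hf : ‖f‖ = 1)
    {x : EuclideanSpace ℂ (Fin (n + 1))} (hx : ‖x‖ = 1) {m : ℝ} (hm : 0 < m)
    (h : muNormVec f x ≤ ENNReal.ofReal m) : ExpandsBy f x (1 / m) := fun v hv => by
  rw [one_div, inv_mul_eq_div, div_le_iff₀' hm]
  exact norm_le_of_muNormVec_le hd hf hx hm.le h hv

/-- A small perturbation of a unit pair `(f, x)` changes the condition number by a factor close
to one. -/
theorem muNormVec_perturb (hd : ∀ i, 1 ≤ d i) {f g : PolySystem d} (hf : ‖f‖ = 1) (hg : ‖g‖ = 1)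
    {x y : EuclideanSpace ℂ (Fin (n + 1))} (hx : ‖x‖ = 1) (hy : ‖y‖ = 1)
    {τ m : ℝ} (hτ : τ < 1) (hm : 0 < m) (hfx : muNormVec f x = ENNReal.ofReal m)
    (hE : Real.exp 2 * (√(maxDegree d) * ‖f - g‖ +
      3 * (maxDegree d * √(maxDegree d) * ‖x - y‖)) ≤ τ / m) :
    ∃ m' : ℝ, 0 < m' ∧ muNormVec g y = ENNReal.ofReal m' ∧ m' ≤ m / (1 - τ) ∧
      m ≤ (1 + τ) * m' := by
  have h1τ : 0 < 1 - τ := by linarith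
  set E := Real.exp 2 * (√(maxDegree d) * ‖f - g‖ +
      3 * (maxDegree d * √(maxDegree d) * ‖x - y‖)) with hEdef
  have hpos : 0 < 1 / m - E := by
    have : (1 - τ) / m ≤ 1 / m - E := by
      rw [sub_div]
      linarith
    exact lt_of_lt_of_le (by positivity) this
  have hg1 : muNormVec g y ≤ ENNReal.ofReal (1 / (1 / m - E)) :=
    ((expandsBy_of_muNormVec_le hd hf hx hm hfx.le).perturb hd g hf hx hy
      (by positivity)).muNormVec_le hd hg hy hpos
  have hfin : muNormVec g y ≠ ⊤ := ne_top_of_le_ne_top ENNReal.ofReal_ne_top hg1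
  have hm' : 0 < (muNormVec g y).toReal := ENNReal.toReal_pos (muNormVec_ne_zero hd hg hy) hfin
  have hgy : muNormVec g y = ENNReal.ofReal (muNormVec g y).toReal :=
    (ENNReal.ofReal_toReal hfin).symm
  refine ⟨(muNormVec g y).toReal, hm', hgy, ?_, ?_⟩
  · rw [hgy, ENNReal.ofReal_le_ofReal_iff (by positivity)] at hg1
    refine hg1.trans ?_
    rw [one_div, ← inv_div (1 - τ) m]
    refine inv_anti₀ (div_pos h1τ hm) ?_
    rw [sub_div]
    linarith
  · set m' := (muNormVec g y).toReal
    -- Perturbation back from (g, y) to (f, x), with the same E. If the inequality failed, the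
    -- constant 1/m' - E would be positive and larger than 1/m, so (f, x) would have condition
    -- number below m.
    have hkey : 1 / m' - E ≤ 1 / m := by
      by_contra! hlt
      have hp : 0 < 1 / m' - E := lt_trans (by positivity) hlt
      have h1 := (expandsBy_of_muNormVec_le hd hg hy hm' hgy.le).perturb hd f hg hy hx
        (by positivity)
      rw [norm_sub_rev g f, norm_sub_rev y x, ← hEdef] at h1
      have h2 := h1.muNormVec_le hd hf hx hp
      rw [hfx, ENNReal.ofReal_le_ofReal_iff (by positivity), le_div_iff₀ hp,
        mul_comm, ← le_div_iff₀ hm] at h2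
      exact absurd hlt (not_lt.2 h2)
    have h3 : 1 / m' ≤ (1 + τ) / m := by
      rw [add_div]
      linarith
    rw [div_le_div_iff₀ hm' hm, one_mul] at h3
    exact h3

end ScaledDeriv

/-! ### Unit representatives realizing the angle -/

section Representatives

variable {E : Type*} [NormedAddCommGroup E] [InnerProductSpace ℂ E]

/-- The chord is shorter than the arc: when the inner product is real and nonnegative, ‖u - v‖² = 2
- 2 cos θ ≤ θ². -/
theorem norm_sub_le_lineAngle {u v : E} (hu : ‖u‖ = 1) (hv : ‖v‖ = 1)
    (h : inner ℂ u v = ((‖inner ℂ u v‖ : ℝ) : ℂ)) : ‖u - v‖ ≤ lineAngle u v := by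
  have hle : ‖(inner ℂ u v : ℂ)‖ ≤ 1 := by
    simpa [hu, hv] using norm_inner_le_norm (𝕜 := ℂ) u v
  have hθ : lineAngle u v = Real.arccos ‖(inner ℂ u v : ℂ)‖ := by
    rw [lineAngle, hu, hv, mul_one, div_one]
  have hcos : Real.cos (lineAngle u v) = ‖(inner ℂ u v : ℂ)‖ := by
    rw [hθ, Real.cos_arccos (by linarith [norm_nonneg (inner ℂ u v : ℂ)]) hle]
  refine le_of_sq_le_sq ?_ (by rw [hθ]; exact Real.arccos_nonneg _)
  have hre : RCLike.re (inner ℂ u v : ℂ) = ‖(inner ℂ u v : ℂ)‖ := by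
    rw [RCLike.re_to_complex]
    conv_lhs => rw [h]
    exact Complex.ofReal_re _
  rw [@norm_sub_sq ℂ, hre, hu, hv]
  linarith [Real.one_sub_sq_div_two_le_cos (x := lineAngle u v)]

theorem exists_unit_mk_eq (p : ℙ ℂ E) :
    ∃ (u : E) (hu : u ≠ 0), ‖u‖ = 1 ∧ Projectivization.mk ℂ u hu = p := by
  have h : ((‖p.rep‖⁻¹ : ℝ) : ℂ) ≠ 0 := by
    exact_mod_cast inv_ne_zero (norm_ne_zero_iff.2 p.rep_nonzero)
  refine ⟨((‖p.rep‖⁻¹ : ℝ) : ℂ) • p.rep, smul_ne_zero h p.rep_nonzero, ?_, ?_⟩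
  · rw [norm_smul, Complex.norm_real, norm_inv, norm_norm,
      inv_mul_cancel₀ (norm_ne_zero_iff.2 p.rep_nonzero)]
  · conv_rhs => rw [← p.mk_rep]
    rw [Projectivization.mk_eq_mk_iff']
    exact ⟨_, rfl⟩

theorem exists_unit_representatives (p q : ℙ ℂ E) :
    ∃ (u v : E) (hu : u ≠ 0) (hv : v ≠ 0), ‖u‖ = 1 ∧ ‖v‖ = 1 ∧
      Projectivization.mk ℂ u hu = p ∧ Projectivization.mk ℂ v hv = q ∧
      ‖u - v‖ ≤ projDist p q := by
  obtain ⟨u, hu0, hu, rfl⟩ := exists_unit_mk_eq p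
  obtain ⟨v, hv0, hv, rfl⟩ := exists_unit_mk_eq q
  -- Multiplying v by this phase keeps its line and makes the inner product with u real and
  -- nonnegative; any phase works for orthogonal vectors.
  obtain ⟨t, ht, htv⟩ : ∃ t : ℂ, ‖t‖ = 1 ∧
      t * inner ℂ u v = ((‖inner ℂ u v‖ : ℝ) : ℂ) := by
    by_cases h0 : (inner ℂ u v : ℂ) = 0
    · exact ⟨1, by simp, by simp [h0]⟩
    · have hn : ‖(inner ℂ u v : ℂ)‖ ≠ 0 := norm_ne_zero_iff.2 h0
      exact ⟨((‖inner ℂ u v‖ : ℝ) : ℂ) / inner ℂ u v, by simp [hn],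
        div_mul_cancel₀ _ h0⟩
  have ht0 : t ≠ 0 := norm_ne_zero_iff.1 (by simp [ht])
  have htv1 : ‖t • v‖ = 1 := by rw [norm_smul, ht, hv, one_mul]
  refine ⟨u, t • v, hu0, smul_ne_zero ht0 hv0, hu, htv1, rfl, ?_, ?_⟩
  · rw [Projectivization.mk_eq_mk_iff']
    exact ⟨t, rfl⟩
  · have h1 : lineAngle u (t • v) = projDist (Projectivization.mk ℂ u hu0)
        (Projectivization.mk ℂ v hv0) := by
      rw [lineAngle_comm, lineAngle_smul_left ht0, lineAngle_comm]
      rfl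
    rw [← h1]
    refine norm_sub_le_lineAngle hu htv1 ?_
    rw [inner_smul_right, norm_mul, ht, one_mul]
    exact htv

end Representatives

/-! ### Real form of the hypotheses and proof of the theorem -/

theorem lt_div_of_ofReal_lt_div {a C D s m : ℝ} (hC : 0 < C) (hD : 0 < D) (hm : 0 < m)
    (h : ENNReal.ofReal a < ENNReal.ofReal C / (ENNReal.ofReal D ^ s * ENNReal.ofReal m)) :
    D ^ s * a < C / m := by
  have hDs : 0 < D ^ s := Real.rpow_pos_of_pos hD s
  rw [ENNReal.ofReal_rpow_of_pos hD, ← ENNReal.ofReal_mul hDs.le,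
    ← ENNReal.ofReal_div_of_pos (by positivity), ENNReal.ofReal_lt_ofReal_iff (by positivity),
    lt_div_iff₀ (by positivity)] at h
  rw [lt_div_iff₀ hm]
  linarith

end Bezout

end

theorem theorem3 (ε : ℝ) (hε : 0 < ε) :
    ∃ C : ℝ, 0 < C ∧
      ∀ (n : ℕ) (d : Fin n → ℕ), (∀ i, 1 ≤ d i) →
        ∀ (f g : ℙ ℂ (Bezout.PolySystem d)) (ζ η : ℙ ℂ (EuclideanSpace ℂ (Fin (n + 1)))),
          ENNReal.ofReal (Bezout.projDist f g) <
              ENNReal.ofReal C /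
                ((Bezout.maxDegree d : ℝ≥0∞) ^ (1 / 2 : ℝ) * Bezout.muNorm f ζ) →
          ENNReal.ofReal (Bezout.projDist ζ η) <
              ENNReal.ofReal C /
                ((Bezout.maxDegree d : ℝ≥0∞) ^ (3 / 2 : ℝ) * Bezout.muNorm f ζ) →
          ENNReal.ofReal (1 / (1 + ε)) * Bezout.muNorm g η ≤ Bezout.muNorm f ζ ∧
            Bezout.muNorm f ζ ≤ ENNReal.ofReal (1 + ε) * Bezout.muNorm g η := by
  -- Chosen so that 1/(1 - τ) = 1 + ε, while also 1 + τ ≤ 1 + ε.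
  set τ : ℝ := ε / (1 + ε) with hτ
  have hτ0 : 0 < τ := by positivity
  have hτ1 : τ < 1 := by rw [hτ, div_lt_one (by positivity)]; linarith
  have hτε : (1 - τ) * (1 + ε) = 1 := by rw [hτ]; field_simp; ring
  have hτε' : τ ≤ ε := by rw [hτ, div_le_iff₀ (by positivity)]; nlinarith
  -- With this C the total error is at most e² (C/m + 3C/m) = τ/m.
  refine ⟨τ / (4 * Real.exp 2), by positivity, ?_⟩
  intro n d hd F G Z Y hFG hZY
  obtain ⟨f, g, hf0, hg0, hf, hg, rfl, rfl, hfg⟩ := Bezout.exists_unit_representatives F G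
  obtain ⟨x, y, hx0, hy0, hx, hy, rfl, rfl, hxy⟩ := Bezout.exists_unit_representatives Z Y
  change _ < _ / (_ * Bezout.muNormVec f x) at hFG
  change _ < _ / (_ * Bezout.muNormVec f x) at hZY
  change _ * Bezout.muNormVec g y ≤ Bezout.muNormVec f x ∧
    Bezout.muNormVec f x ≤ _ * Bezout.muNormVec g y
  have hD1 : (1 : ℝ) ≤ Bezout.maxDegree d := Bezout.one_le_maxDegree hd hf0
  have hD0 : (0 : ℝ) < Bezout.maxDegree d := by linarith
  -- For an infinite condition number the hypothesis bounds a distance strictly by C/∞ = 0, which is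
  -- impossible. That D ≠ 0 matters here, because 0 · ∞ = 0 in `ℝ≥0∞`.
  have hfin : Bezout.muNormVec f x ≠ ⊤ := fun htop => by
    have hDne : (Bezout.maxDegree d : ℝ≥0∞) ^ (1 / 2 : ℝ) ≠ 0 := by
      have : Bezout.maxDegree d ≠ 0 := by exact_mod_cast hD0.ne'
      simp [this]
    rw [htop, ENNReal.mul_top hDne, ENNReal.div_top] at hFG
    exact not_lt_zero hFG
  have hm : 0 < (Bezout.muNormVec f x).toReal :=
    ENNReal.toReal_pos (Bezout.muNormVec_ne_zero hd hf hx) hfin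
  have hfx : Bezout.muNormVec f x = ENNReal.ofReal (Bezout.muNormVec f x).toReal :=
    (ENNReal.ofReal_toReal hfin).symm
  set m := (Bezout.muNormVec f x).toReal
  rw [hfx, ← ENNReal.ofReal_natCast] at hFG hZY
  have h1 := Bezout.lt_div_of_ofReal_lt_div (by positivity) hD0 hm hFG
  have h2 := Bezout.lt_div_of_ofReal_lt_div (by positivity) hD0 hm hZY
  rw [← Real.sqrt_eq_rpow] at h1
  have h32 : (Bezout.maxDegree d : ℝ) ^ (3 / 2 : ℝ) =
      Bezout.maxDegree d * √(Bezout.maxDegree d : ℝ) := by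
    rw [Real.sqrt_eq_rpow, ← Real.rpow_one_add' hD0.le (by norm_num)]
    norm_num
  rw [h32] at h2
  set D : ℝ := (Bezout.maxDegree d : ℝ)
  have hE : Real.exp 2 * (√D * ‖f - g‖ + 3 * (D * √D * ‖x - y‖)) ≤ τ / m := by
    have h3 := (mul_le_mul_of_nonneg_left hfg (Real.sqrt_nonneg D)).trans h1.le
    have h4 := (mul_le_mul_of_nonneg_left hxy
      (mul_nonneg hD0.le (Real.sqrt_nonneg D))).trans h2.le
    calc Real.exp 2 * (√D * ‖f - g‖ + 3 * (D * √D * ‖x - y‖))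
        ≤ Real.exp 2 * (τ / (4 * Real.exp 2) / m + 3 * (τ / (4 * Real.exp 2) / m)) := by
          gcongr
      _ = τ / m := by
          have := (Real.exp_pos 2).ne'
          field_simp
          ring
  obtain ⟨m', hm', hgy, hle, hle'⟩ :=
    Bezout.muNormVec_perturb hd hf hg hx hy hτ1 hm hfx hE
  rw [hfx, hgy, ← ENNReal.ofReal_mul (by positivity), ← ENNReal.ofReal_mul (by positivity)]
  refine ⟨ENNReal.ofReal_le_ofReal ?_, ENNReal.ofReal_le_ofReal ?_⟩
  · rw [one_div, inv_mul_eq_div, div_le_iff₀ (by positivity)]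
    refine hle.trans_eq ?_
    rw [div_eq_iff (by linarith), mul_assoc, mul_comm (1 + ε), hτε, mul_one]
  · refine hle'.trans ?_
    gcongr
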